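/- \textbf{Conventions.} A \emph{signature} is a set of relation symbols, each with an arity. An \emph{interpretation} consists of a non-empty (finite or infinite) domain and a relation on it for each symbol. An \emph{atom} is $R(x_1,\dots,x_k)$ with variables $x_i$ and $R$ of arity $k$. A \emph{fact} $F$ and a \emph{Boolean conjunctive query} $q$ are finite conjunctions of atoms, both read under their existential closure. An \emph{existential rule} is a sentence $\forall \mathbf{x}\,(\varphi(\mathbf{x}) \to \exists \mathbf{y}\,\psi(\mathbf{x}',\mathbf{y}))$, where $\varphi,\psi$ are finite conjunctions of atoms and $\mathbf{x}'\subseteq\mathbf{x}$; its \emph{frontier} is the set of variables that occur in both $\varphi$ and $\psi$, and the rule is \emph{frontier-one} (in $\mathsf{FR}[1]$) if its frontier has exactly one element. An \emph{$\mathcal{ALCF}$ constraint} is a concept inclusion $C\sqsubseteq E$ between $\mathcal{ALC}$ concepts (built by $\top,\bot,A,\neg,\sqcap,\sqcup,\exists r.C,\forall r.C$ from unary relation symbols $A$ and binary relation symbols $r$) or a functionality assertion $\mathrm{funct}(r)$ (no element has two distinct $r$-successors) for a binary symbol $r$. $\mathsf{GC}^2$ is the guarded two-variable fragment of first-order logic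 with counting, over unary and binary symbols: it contains the atoms and equalities over the variables $x_0,x_1$, and is closed under Boolean connectives, under $\exists u\,\varphi$ and $\forall u\,\varphi$ for $\varphi$ with at most one free variable, and under $\exists^{\ge n}u\,(\gamma\wedge\varphi)$ where $\gamma$ is a binary relational atom containing both variables (other guarded quantifiers being definable from this). Given a fact $F$, a finite set $\Delta$ of rules and a finite set $\Gamma$ of constraints, \emph{satisfiability} asks whether some interpretation satisfies $F$, $\Delta$ and $\Gamma$; given in addition a Boolean conjunctive query $q$, \emph{query answering} (QA) asks whether every interpretation that satisfies $F$, $\Delta$ and $\Gamma$ satisfies $q$. \textbf{Theorem.} Combining frontier-one rules with description logics is destructive: \begin{enumerate} \item There are a finite signature $\sigma$ of unary and binary relation symbols, a single frontier-one rule $\tau$, a finite set $\Gamma$ of $\mathcal{ALCF}$ constraints and a Boolean conjunctive query $q$, all over $\sigma$, such that, with a fact $F$ over $\sigma$ as the only input, both satisfiability of $F$, $\{\tau\}$, $\Gamma$ and QA for $F$, $\{\tau\}$, $\Gamma$ and $q$ are undecidable. \item The same holds with a finite set of $\mathsf{GC}^2$ sentences in place of the $\mathcal{ALCF}$ constraints.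 \item Consequently satisfiability and QA are undecidable for $\mathsf{FR}[1]\wedge\mathcal{ALCF}$, and for $\mathsf{FR}[1]\wedge\mathsf{GC}^2$, i.e. when the fact, a finite set of frontier-one rules, a finite set of $\mathcal{ALCF}$ constraints (respectively $\mathsf{GC}^2$ sentences) and, for QA, the Boolean conjunctive query are all part of the input. \end{enumerate} -/

import Mathlib

namespace DLRules

/-! ### Decision problems -/

/-- The decision problem whose instances are the `x` with `inst x` and whose yes-instances are those
with `p x` is decidable: some (total) computable function answers correctly on every instance. Its
values on inputs that are not instances are irrelevant. -/
def DecidableOn {α : Type} [Primcodable α] (inst p : α → Prop) : Prop :=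
  ∃ f : α → Bool, Computable f ∧ ∀ x, inst x → (f x = true ↔ p x)

/-! ### Relational syntax

A relation symbol is a pair (name, arity), so there are infinitely many symbols of each arity.
Variables are natural numbers. There are no constants and no function symbols. -/

/-- A relation symbol: its name and its arity. -/
abbrev RelSymbol : Type := ℕ × ℕ

/-- The atom `R(x₁, …, xₖ)` is the name of `R` with the list `[x₁, …, xₖ]`; its relation symbol has
the length of that list as arity. -/
abbrev Atom : Type := ℕ × List ℕ

/-- The relation symbol of an atom. -/
def Atom.symbol (a : Atom) : RelSymbol := (a.1, a.2.length)

/-- The variables of an atom. -/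
def Atom.vars (a : Atom) : Finset ℕ := a.2.toFinset

/-- A fact: a finite conjunction of atoms, to be read under its existential closure. -/
abbrev Fact : Type := List Atom

/-- A Boolean conjunctive query: an existentially quantified finite conjunction of atoms. -/
abbrev BCQ : Type := List Atom

/-- The variables of a conjunction of atoms. -/
def conjVars (l : List Atom) : Finset ℕ := l.toFinset.biUnion Atom.vars

/-- All atoms of the conjunction are over the signature `σ`. -/
def conjOver (σ : Finset RelSymbol) (l : List Atom) : Prop := ∀ a ∈ l, Atom.symbol a ∈ σ

/-- An existential rule `∀ 𝐱 (φ(𝐱) → ∃ 𝐲 ψ(𝐱', 𝐲))`, as the pair of its body `φ` and its head `ψ`.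
The variables of the head that do not occur in the body are the existential ones. -/
abbrev Rule : Type := List Atom × List Atom

/-- The frontier of a rule: the variables that occur both in its body and in its head. -/
def Rule.frontier (τ : Rule) : Finset ℕ := conjVars τ.1 ∩ conjVars τ.2

/-- The class `FR[1]`: the frontier consists of exactly one variable. -/
def Rule.FrontierOne (τ : Rule) : Prop := (Rule.frontier τ).card = 1

/-- The rule is over the signature `σ`. -/
def Rule.Over (σ : Finset RelSymbol) (τ : Rule) : Prop := conjOver σ τ.1 ∧ conjOver σ τ.2

/-! ### Interpretations -/

/-- A relational interpretation with domain `D`. The relation symbol of name `r` and arity `k` is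
interpreted by the tuples of length `k` in `rel r`. -/
structure Interpretation (D : Type) where
  rel : ℕ → Set (List D)

/-- The atom holds under a valuation of the variables. -/
def Interpretation.Holds {D : Type} (I : Interpretation D) (v : ℕ → D) (a : Atom) : Prop :=
  a.2.map v ∈ I.rel a.1

/-- The interpretation satisfies the existential closure of a conjunction of atoms. -/
def Interpretation.SatConj {D : Type} (I : Interpretation D) (l : List Atom) : Prop :=
  ∃ v : ℕ → D, ∀ a ∈ l, I.Holds v a

/-- The interpretation satisfies an existential rule. -/
def Interpretation.SatRule {D : Type} (I : Interpretation D) (τ : Rule) : Prop :=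
  ∀ v : ℕ → D, (∀ a ∈ τ.1, I.Holds v a) →
    ∃ w : ℕ → D, (∀ x ∈ Rule.frontier τ, w x = v x) ∧ ∀ a ∈ τ.2, I.Holds w a

/-! ### The description logic ALCF -/

/-- Concepts of `ALC`. Concept names are the unary, role names the binary relation symbols. -/
inductive Concept : Type
  | top : Concept
  | bot : Concept
  | name (A : ℕ) : Concept
  | neg (C : Concept) : Concept
  | inter (C E : Concept) : Concept
  | union (C E : Concept) : Concept
  | ex (r : ℕ) (C : Concept) : Concept
  | all (r : ℕ) (C : Concept) : Concept

namespace Concept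

/-- The extension of a concept in an interpretation. -/
def ext {D : Type} (I : Interpretation D) : Concept → Set D
  | top => Set.univ
  | bot => ∅
  | name A => {d | [d] ∈ I.rel A}
  | neg C => (ext I C)ᶜ
  | inter C E => ext I C ∩ ext I E
  | union C E => ext I C ∪ ext I E
  | ex r C => {d | ∃ e, [d, e] ∈ I.rel r ∧ e ∈ ext I C}
  | all r C => {d | ∀ e, [d, e] ∈ I.rel r → e ∈ ext I C}

/-- The relation symbols of a concept. -/
def symbols : Concept → Finset RelSymbol
  | top => ∅
  | bot => ∅
  | name A => {(A, 1)}
  | neg C => symbols C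
  | inter C E => symbols C ∪ symbols E
  | union C E => symbols C ∪ symbols E
  | ex r C => insert (r, 2) (symbols C)
  | all r C => insert (r, 2) (symbols C)

/-- Gödel numbering of concepts. -/
def toNat : Concept → ℕ
  | top => 0
  | bot => 1
  | name A => 6 * A + 2
  | neg C => 6 * toNat C + 3
  | inter C E => 6 * Nat.pair (toNat C) (toNat E) + 4
  | union C E => 6 * Nat.pair (toNat C) (toNat E) + 5
  | ex r C => 6 * Nat.pair r (toNat C) + 6
  | all r C => 6 * Nat.pair r (toNat C) + 7

/-- The inverse of the Gödel numbering. -/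
def ofNat : ℕ → Concept
  | 0 => top
  | 1 => bot
  | n + 2 =>
    have hm : n / 6 < n + 2 := by omega
    have _m1 : (n / 6).unpair.1 < n + 2 := lt_of_le_of_lt (Nat.unpair_left_le _) hm
    have _m2 : (n / 6).unpair.2 < n + 2 := lt_of_le_of_lt (Nat.unpair_right_le _) hm
    match n % 6 with
    | 0 => name (n / 6)
    | 1 => neg (ofNat (n / 6))
    | 2 => inter (ofNat (n / 6).unpair.1) (ofNat (n / 6).unpair.2)
    | 3 => union (ofNat (n / 6).unpair.1) (ofNat (n / 6).unpair.2)
    | 4 => ex (n / 6).unpair.1 (ofNat (n / 6).unpair.2)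
    | _ => all (n / 6).unpair.1 (ofNat (n / 6).unpair.2)

theorem ofNat_toNat (C : Concept) : ofNat (toNat C) = C := by
  induction C with
  | top => simp [toNat, ofNat]
  | bot => simp [toNat, ofNat]
  | name A => simp [toNat, ofNat]
  | neg C ih =>
    rw [toNat, ofNat]
    have h1 : (6 * toNat C + 1) % 6 = 1 := by omega
    have h2 : (6 * toNat C + 1) / 6 = toNat C := by omega
    simp [h1, h2, ih]
  | inter C E ih1 ih2 =>
    rw [toNat, ofNat]
    have h1 : (6 * Nat.pair (toNat C) (toNat E) + 2) % 6 = 2 := by omega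
    have h2 : (6 * Nat.pair (toNat C) (toNat E) + 2) / 6 = Nat.pair (toNat C) (toNat E) := by omega
    simp [h1, h2, ih1, ih2]
  | union C E ih1 ih2 =>
    rw [toNat, ofNat]
    have h1 : (6 * Nat.pair (toNat C) (toNat E) + 3) % 6 = 3 := by omega
    have h2 : (6 * Nat.pair (toNat C) (toNat E) + 3) / 6 = Nat.pair (toNat C) (toNat E) := by omega
    simp [h1, h2, ih1, ih2]
  | ex r C ih =>
    rw [toNat, ofNat]
    have h1 : (6 * Nat.pair r (toNat C) + 4) % 6 = 4 := by omega
    have h2 : (6 * Nat.pair r (toNat C) + 4) / 6 = Nat.pair r (toNat C) := by omega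
    simp [h1, h2, ih]
  | all r C ih =>
    rw [toNat, ofNat]
    have h1 : (6 * Nat.pair r (toNat C) + 5) % 6 = 5 := by omega
    have h2 : (6 * Nat.pair r (toNat C) + 5) / 6 = Nat.pair r (toNat C) := by omega
    simp [h1, h2, ih]

theorem toNat_ofNat (n : ℕ) : toNat (ofNat n) = n := by
  induction n using Nat.strong_induction_on with
  | _ n ih =>
    match n with
    | 0 => simp [toNat, ofNat]
    | 1 => simp [toNat, ofNat]
    | n + 2 =>
      have hm : n / 6 < n + 2 := by omega
      have h0 := ih _ hm
      have h1 := ih _ (lt_of_le_of_lt (Nat.unpair_left_le (n / 6)) hm)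
      have h2 := ih _ (lt_of_le_of_lt (Nat.unpair_right_le (n / 6)) hm)
      rw [ofNat]
      have hlt : n % 6 < 6 := Nat.mod_lt _ (by omega)
      have hd := Nat.div_add_mod n 6
      generalize n % 6 = k at hlt hd ⊢
      interval_cases k <;> simp [toNat, h0, h1, h2] <;> omega

instance : Denumerable Concept :=
  Denumerable.mk' ⟨toNat, ofNat, ofNat_toNat, toNat_ofNat⟩

end Concept

/-- Constraints of `ALCF`: concept inclusions `C ⊑ E` and functionality assertions `funct(r)`. -/
inductive ALCFConstraint : Type
  | incl (C E : Concept) : ALCFConstraint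
  | funct (r : ℕ) : ALCFConstraint

namespace ALCFConstraint

/-- The interpretation satisfies the constraint. -/
def Sat {D : Type} (I : Interpretation D) : ALCFConstraint → Prop
  | incl C E => C.ext I ⊆ E.ext I
  | funct r => ∀ d e e' : D, [d, e] ∈ I.rel r → [d, e'] ∈ I.rel r → e = e'

/-- The relation symbols of a constraint. -/
def symbols : ALCFConstraint → Finset RelSymbol
  | incl C E => C.symbols ∪ E.symbols
  | funct r => {(r, 2)}

/-- A constraint is a pair of concepts or a role name. -/
def equivSum : ALCFConstraint ≃ (Concept × Concept) ⊕ ℕ where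
  toFun
    | incl C E => Sum.inl (C, E)
    | funct r => Sum.inr r
  invFun
    | Sum.inl (C, E) => incl C E
    | Sum.inr r => funct r
  left_inv c := by cases c <;> rfl
  right_inv s := by rcases s with ⟨C, E⟩ | r <;> rfl

instance : Denumerable ALCFConstraint := Denumerable.ofEquiv _ equivSum

end ALCFConstraint

/-! ### First-order logic with counting quantifiers, and its fragment GC² -/

/-- First-order formulas with equality and counting quantifiers: `exGe n i φ` is `∃^{≥ n} xᵢ φ`.
The other connectives and quantifiers are abbreviations: `∃ xᵢ φ` is `∃^{≥ 1} xᵢ φ`, `∀ xᵢ φ` is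
`¬ ∃ xᵢ ¬ φ`, `∃^{≤ n} xᵢ φ` is `¬ ∃^{≥ n+1} xᵢ φ`. -/
inductive Formula : Type
  | atom (a : Atom) : Formula
  | eq (i j : ℕ) : Formula
  | neg (φ : Formula) : Formula
  | and (φ ψ : Formula) : Formula
  | exGe (n i : ℕ) (φ : Formula) : Formula

namespace Formula

/-- Satisfaction under a valuation. -/
def Sat {D : Type} (I : Interpretation D) : Formula → (ℕ → D) → Prop
  | atom a, v => I.Holds v a
  | eq i j, v => v i = v j
  | neg φ, v => ¬ Sat I φ v
  | and φ ψ, v => Sat I φ v ∧ Sat I ψ v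
  | exGe n i φ, v => ∃ s : Finset D, s.card = n ∧ ∀ d ∈ s, Sat I φ (Function.update v i d)

/-- The free variables. -/
def freeVars : Formula → Finset ℕ
  | atom a => Atom.vars a
  | eq i j => {i, j}
  | neg φ => freeVars φ
  | and φ ψ => freeVars φ ∪ freeVars ψ
  | exGe _ i φ => (freeVars φ).erase i

/-- The relation symbols. -/
def symbols : Formula → Finset RelSymbol
  | atom a => {Atom.symbol a}
  | eq _ _ => ∅
  | neg φ => symbols φ
  | and φ ψ => symbols φ ∪ symbols ψ
  | exGe _ _ φ => symbols φ

/-- The guarded two-variable fragment with counting, over unary and binary relation symbols and the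
two variables `x₀`, `x₁`: it contains the atoms and equalities, it is closed under Boolean
connectives, under plain quantification of formulas with at most one free variable, and under
counting quantification `∃^{≥ n} u (γ ∧ φ)`, where the guard `γ` is a binary (non-equality) atom in
which both variables occur. -/
inductive GC2 : Formula → Prop
  | unary (r i : ℕ) : i < 2 → GC2 (atom (r, [i]))
  | binary (r i j : ℕ) : i < 2 → j < 2 → GC2 (atom (r, [i, j]))
  | eq (i j : ℕ) : i < 2 → j < 2 → GC2 (eq i j)
  | neg (φ : Formula) : GC2 φ → GC2 (neg φ)
  | and (φ ψ : Formula) : GC2 φ → GC2 ψ → GC2 (and φ ψ)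
  | ex (u : ℕ) (φ : Formula) : u < 2 → φ.freeVars.card ≤ 1 → GC2 φ → GC2 (exGe 1 u φ)
  | guarded (n u r i j : ℕ) (φ : Formula) : u < 2 → i < 2 → j < 2 → i ≠ j → GC2 φ →
      GC2 (exGe n u (and (atom (r, [i, j])) φ))

/-- Sentences of `GC²`. -/
def GC2Sentence (φ : Formula) : Prop := GC2 φ ∧ φ.freeVars = ∅

/-- Truth of a sentence in an interpretation. -/
def IsTrue {D : Type} (I : Interpretation D) (φ : Formula) : Prop := ∀ v : ℕ → D, Sat I φ v

/-- Gödel numbering of formulas. -/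
def toNat : Formula → ℕ
  | atom a => 5 * Encodable.encode a
  | eq i j => 5 * Nat.pair i j + 1
  | neg φ => 5 * toNat φ + 2
  | and φ ψ => 5 * Nat.pair (toNat φ) (toNat ψ) + 3
  | exGe n i φ => 5 * Nat.pair n (Nat.pair i (toNat φ)) + 4

/-- The inverse of the Gödel numbering. -/
def ofNat (n : ℕ) : Formula :=
  if h0 : n % 5 = 0 then atom (Denumerable.ofNat Atom (n / 5))
  else
    have hm : n / 5 < n := by omega
    have _m1 : (n / 5).unpair.1 < n := lt_of_le_of_lt (Nat.unpair_left_le _) hm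
    have m2 : (n / 5).unpair.2 < n := lt_of_le_of_lt (Nat.unpair_right_le _) hm
    have _m3 : (n / 5).unpair.2.unpair.2 < n := lt_of_le_of_lt (Nat.unpair_right_le _) m2
    if n % 5 = 1 then eq (n / 5).unpair.1 (n / 5).unpair.2
    else if n % 5 = 2 then neg (ofNat (n / 5))
    else if n % 5 = 3 then and (ofNat (n / 5).unpair.1) (ofNat (n / 5).unpair.2)
    else exGe (n / 5).unpair.1 (n / 5).unpair.2.unpair.1 (ofNat (n / 5).unpair.2.unpair.2)
termination_by n

theorem ofNat_toNat (φ : Formula) : ofNat (toNat φ) = φ := by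
  induction φ with
  | atom a =>
    rw [toNat, ofNat]
    have h1 : 5 * Encodable.encode a % 5 = 0 := by omega
    have h2 : 5 * Encodable.encode a / 5 = Encodable.encode a := by omega
    rw [dif_pos h1, h2, Denumerable.ofNat_encode]
  | eq i j =>
    rw [toNat, ofNat]
    have h1 : (5 * Nat.pair i j + 1) % 5 = 1 := by omega
    have h2 : (5 * Nat.pair i j + 1) / 5 = Nat.pair i j := by omega
    simp [h1, h2]
  | neg φ ih =>
    rw [toNat, ofNat]
    have h1 : (5 * toNat φ + 2) % 5 = 2 := by omega
    have h2 : (5 * toNat φ + 2) / 5 = toNat φ := by omega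
    simp [h1, h2, ih]
  | and φ ψ ih1 ih2 =>
    rw [toNat, ofNat]
    have h1 : (5 * Nat.pair (toNat φ) (toNat ψ) + 3) % 5 = 3 := by omega
    have h2 : (5 * Nat.pair (toNat φ) (toNat ψ) + 3) / 5 = Nat.pair (toNat φ) (toNat ψ) := by omega
    simp [h1, h2, ih1, ih2]
  | exGe n i φ ih =>
    rw [toNat, ofNat]
    have h1 : (5 * Nat.pair n (Nat.pair i (toNat φ)) + 4) % 5 = 4 := by omega
    have h2 : (5 * Nat.pair n (Nat.pair i (toNat φ)) + 4) / 5
        = Nat.pair n (Nat.pair i (toNat φ)) := by omega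
    simp [h1, h2, ih]

theorem toNat_ofNat (n : ℕ) : toNat (ofNat n) = n := by
  induction n using Nat.strong_induction_on with
  | _ n ih =>
    have hlt : n % 5 < 5 := Nat.mod_lt _ (by omega)
    have hd := Nat.div_add_mod n 5
    rw [ofNat]
    by_cases h0 : n % 5 = 0
    · simp [h0, toNat]; omega
    · have hm : n / 5 < n := by omega
      have m2 := lt_of_le_of_lt (Nat.unpair_right_le (n / 5)) hm
      have e0 := ih _ hm
      have e1 := ih _ (lt_of_le_of_lt (Nat.unpair_left_le (n / 5)) hm)
      have e2 := ih _ m2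
      have e3 := ih _ (lt_of_le_of_lt (Nat.unpair_right_le (n / 5).unpair.2) m2)
      rw [dif_neg h0]
      split_ifs with h1 h2 h3 <;> simp [toNat, e0, e1, e2, e3] <;> omega

instance : Denumerable Formula :=
  Denumerable.mk' ⟨toNat, ofNat, ofNat_toNat, toNat_ofNat⟩

end Formula

/-! ### Satisfiability and query answering

Interpretations are arbitrary (finite or infinite) with a non-empty domain; by the downward
Löwenheim–Skolem theorem the universe of the domain does not matter. -/

section Reasoning

variable {L : Type} (sat : ∀ {D : Type}, Interpretation D → L → Prop)

/-- The interpretation satisfies the rules `Δ` and the constraints `Γ` of a logic `L` whose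
satisfaction relation is `sat`. -/
def Models {D : Type} (I : Interpretation D) (Δ : List Rule) (Γ : List L) : Prop :=
  (∀ τ ∈ Δ, I.SatRule τ) ∧ ∀ c ∈ Γ, sat I c

/-- Satisfiability: some interpretation satisfies `Δ`, `Γ` and the existential closure of `F`. -/
def Satisfiable (F : Fact) (Δ : List Rule) (Γ : List L) : Prop :=
  ∃ (D : Type) (_ : Nonempty D) (I : Interpretation D), I.SatConj F ∧ Models sat I Δ Γ

/-- Query answering: every interpretation of `Δ`, `Γ` and the existential closure of `F`
satisfies `q`. -/
def Entails (F : Fact) (Δ : List Rule) (Γ : List L) (q : BCQ) : Prop :=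
  ∀ (D : Type) (_ : Nonempty D) (I : Interpretation D),
    I.SatConj F → Models sat I Δ Γ → I.SatConj q

end Reasoning

/-- Satisfaction of `ALCF` constraints. -/
def satALCF {D : Type} (I : Interpretation D) (c : ALCFConstraint) : Prop := c.Sat I

/-- Satisfaction of first-order sentences. -/
def satFO {D : Type} (I : Interpretation D) (φ : Formula) : Prop := φ.IsTrue I

end DLRules

/-!
Functional roles are unary functions, and the head of a frontier-one rule can demand any finite
pattern of paths that start at the frontier variable. If every element is an instance of the body,
the rule can therefore make every role of a finite list total, and make finitely many equations
between compositions of roles hold at every element: the models of the rule and of the functionality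
assertions are the actions of a finitely presented monoid (`satisfiable_iff_exists_action`). A fact
that consists of a path then asks about a word of this monoid.

The monoid encodes a universal Turing machine (`MachineRel`): configurations are words, and each
transition is an equation. A letter `halted` replaces the state and the scanned symbol on halting,
and absorbs all tape symbols. If the machine halts on the input, the equations take the word of the
initial configuration to the word of the halted one (`configNode_of_halts`). If it does not, then
there is an action that separates them (`Node.move_rel`): an element remembers the part of the tape
to the left of the state, and, once the state has been read, only for which continuations the
resulting configuration halts. As a configuration halts if and only if its successor does, this
action satisfies the equations, with no need to analyse how a word can be rewritten. A constraint
excludes that the path of the fact ends where a halted configuration does, so satisfiability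
amounts to running forever. A query that contradicts this constraint turns query answering into
unsatisfiability.

The constraints are simple enough to be written in `ALCF` and in `GC²` (`ExpressAction`). The
machine is the one that Mathlib compiles from a code for a universal partial recursive function
(`exists_universal_machine`).
-/

namespace DLRules

open Turing

/-! ### A universal Turing machine -/

/-- `trNat` writes the binary digits of a number, least significant first. -/
theorem trNat_eq_bits (n : ℕ) :
    PartrecToTM2.trNat n =
      (Nat.bits n).map fun b => cond b PartrecToTM2.Γ'.bit1 PartrecToTM2.Γ'.bit0 := by
  have hpos : ∀ p : PosNum, PartrecToTM2.trPosNum p =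
      (Nat.bits (p : ℕ)).map fun b => cond b PartrecToTM2.Γ'.bit1 PartrecToTM2.Γ'.bit0 := by
    intro p
    induction p with
    | one => simp [PartrecToTM2.trPosNum]
    | bit0 p ih =>
      have hp : (p : ℕ) ≠ 0 := (PosNum.cast_pos (α := ℕ) p).ne'
      have h2 : ((PosNum.bit0 p : PosNum) : ℕ) = 2 * (p : ℕ) := by
        rw [PosNum.cast_bit0]; ring
      rw [h2, Nat.bit0_bits _ hp]
      simp [PartrecToTM2.trPosNum, ih]
    | bit1 p ih =>
      have h2 : ((PosNum.bit1 p : PosNum) : ℕ) = 2 * (p : ℕ) + 1 := by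
        rw [PosNum.cast_bit1]; ring
      rw [h2, Nat.bit1_bits]
      simp [PartrecToTM2.trPosNum, ih]
  have hnum : ∀ m : Num, PartrecToTM2.trNum m =
      (Nat.bits (m : ℕ)).map fun b => cond b PartrecToTM2.Γ'.bit1 PartrecToTM2.Γ'.bit0 := by
    rintro (_ | p)
    · simp [PartrecToTM2.trNum]
    · exact hpos p
  rw [PartrecToTM2.trNat, hnum, Num.to_of_nat]

theorem primrec_bits : Primrec Nat.bits := by
  -- Course-of-values recursion: the list `prev` holds the digits of all smaller numbers.
  let g : List (List Bool) → Option (List Bool) := fun prev =>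
    if prev.length = 0 then some [] else
      some (decide (prev.length % 2 = 1) :: (prev.getD (prev.length / 2) []))
  have hg : Primrec g := by
    refine Primrec.ite (Primrec.eq.comp Primrec.list_length (Primrec.const 0))
      (Primrec.const _) (Primrec.option_some.comp ?_)
    refine Primrec.list_cons.comp ?_ ?_
    · exact PrimrecPred.decide (Primrec.eq.comp
        (Primrec.nat_mod.comp Primrec.list_length (Primrec.const 2)) (Primrec.const 1))
    · exact (Primrec.list_getD []).comp Primrec.id
        (Primrec.nat_div.comp Primrec.list_length (Primrec.const 2))
  have key : Primrec₂ fun (_ : Unit) n => Nat.bits n := by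
    refine Primrec.nat_strong_rec (fun (_ : Unit) n => Nat.bits n) (g := fun _ => g)
      (hg.comp Primrec.snd) ?_
    rintro - n
    rcases Nat.eq_zero_or_pos n with rfl | hn
    · simp [g]
    · have hlt : n / 2 < n := by omega
      have hb : Nat.bits n = decide (n % 2 = 1) :: Nat.bits (n / 2) := by
        rcases Nat.mod_two_eq_zero_or_one n with h | h
        · have h2 : n = 2 * (n / 2) := by omega
          conv_lhs => rw [h2, Nat.bit0_bits _ (by omega)]
          simp [h]
        · have h2 : n = 2 * (n / 2) + 1 := by omega
          conv_lhs => rw [h2, Nat.bit1_bits]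
          simp [h]
      simp [g, hn.ne', hb, hlt]
  exact key.comp (Primrec.const ()) Primrec.id

/-- A universal one-tape machine with finitely many tape symbols, and finitely many states
reachable from the initial one: whether it halts on an input word, written in a binary alphabet
after a fixed first letter, is undecidable. -/
theorem exists_universal_machine :
    ∃ (Γ Λ : Type) (_ : Inhabited Γ) (_ : Inhabited Λ) (_ : Finite Γ) (M : TM0.Machine Γ Λ)
      (S : Set Λ) (a : Γ) (β : Bool → Γ), S.Finite ∧ TM0.Supports M S ∧
      ¬ ComputablePred fun s : List Bool => (TM0.eval M (a :: s.map β)).Dom := by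
  classical
  have hf : Partrec fun n : ℕ => Nat.Partrec.Code.eval (Denumerable.ofNat _ n) 0 :=
    Nat.Partrec.Code.eval_part.comp (Computable.ofNat _) (Computable.const 0)
  obtain ⟨c, hc⟩ := ToPartrec.Code.exists_code (Nat.Partrec'.part_iff₁.2 hf)
  let _ : Inhabited PartrecToTM2.Λ' := ⟨PartrecToTM2.trNormal c PartrecToTM2.Cont'.halt⟩
  let M₁ := TM2to1.tr PartrecToTM2.tr
  have h₁ : TM1.Supports M₁ _ :=
    TM2to1.tr_supports PartrecToTM2.tr (PartrecToTM2.tr_supports c PartrecToTM2.Cont'.halt)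
  have h₀ := TM1to0.tr_supports M₁ h₁
  let sym (b : Bool) (x : PartrecToTM2.Γ') :
      TM2to1.Γ' PartrecToTM2.K' (fun _ => PartrecToTM2.Γ') :=
    (b, Function.update (fun _ => none) PartrecToTM2.K'.main (some x))
  refine ⟨TM2to1.Γ' PartrecToTM2.K' (fun _ => PartrecToTM2.Γ'), _, inferInstance, inferInstance,
    ?_, TM1to0.tr M₁, _, sym true PartrecToTM2.Γ'.cons,
    fun b => sym false (cond b PartrecToTM2.Γ'.bit1 PartrecToTM2.Γ'.bit0),
    Finset.finite_toSet _, h₀, fun hdec => ?_⟩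
  · have hinj : Function.Injective fun k : PartrecToTM2.K' =>
        ((match k with | .main => 0 | .rev => 1 | .aux => 2 | .stack => 3) : Fin 4) := by
      rintro ⟨⟩ ⟨⟩ h <;> first | rfl | cases h
    have := Finite.of_injective _ hinj
    exact inferInstanceAs (Finite (Bool × (PartrecToTM2.K' → Option PartrecToTM2.Γ')))
  · refine ComputablePred.halting_problem 0 ?_
    have hcomp : Computable fun e : Nat.Partrec.Code => (Nat.bits (Encodable.encode e)).reverse :=
      (Primrec.list_reverse.comp (primrec_bits.comp Primrec.encode)).to_comp
    refine (ComputablePred.computable_iff.2 ?_)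
    obtain ⟨f, hf, hfe⟩ := ComputablePred.computable_iff.1 hdec
    refine ⟨_, hf.comp hcomp, ?_⟩
    funext e
    have hfe' := congrFun hfe (Nat.bits (Encodable.encode e)).reverse
    rw [← hfe', TM1to0.tr_eval]
    -- The bottom of the stack comes first on the tape, so the separator precedes the digits.
    have hL : PartrecToTM2.trList [Encodable.encode e] =
        (PartrecToTM2.Γ'.cons :: (Nat.bits (Encodable.encode e)).reverse.map
          fun b => cond b PartrecToTM2.Γ'.bit1 PartrecToTM2.Γ'.bit0).reverse := by
      simp [PartrecToTM2.trList, trNat_eq_bits]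
    have hinit : sym true PartrecToTM2.Γ'.cons :: (Nat.bits (Encodable.encode e)).reverse.map
          (fun b => sym false (cond b PartrecToTM2.Γ'.bit1 PartrecToTM2.Γ'.bit0)) =
        TM2to1.trInit PartrecToTM2.K'.main (PartrecToTM2.trList [Encodable.encode e]) := by
      rw [hL, TM2to1.trInit, List.reverse_reverse]
      have h := List.map_map (g := sym false)
        (f := fun b => cond b PartrecToTM2.Γ'.bit1 PartrecToTM2.Γ'.bit0)
        (l := (Nat.bits (Encodable.encode e)).reverse)
      exact congrArg (List.cons (sym true PartrecToTM2.Γ'.cons)) h.symm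
    -- The initial label of the stack machine is the `default` one, chosen above for `c`.
    have hi : (TM2.init PartrecToTM2.K'.main (PartrecToTM2.trList [Encodable.encode e]) :
        TM2.Cfg (fun _ : PartrecToTM2.K' => PartrecToTM2.Γ') PartrecToTM2.Λ'
          (Option PartrecToTM2.Γ')) = PartrecToTM2.init c [Encodable.encode e] := by
      unfold TM2.init PartrecToTM2.init
      congr 1
      funext k
      cases k <;> rfl
    have hce := hc ⟨[Encodable.encode e], rfl⟩
    rw [hinit]
    refine propext (Iff.trans ?_ (TM2to1.tr_eval_dom PartrecToTM2.tr _ _).symm)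
    simp only [TM2.eval, hi, PartrecToTM2.tr_eval]
    rw [hce]
    simp only [List.Vector.head, Denumerable.ofNat_encode]
    exact Iff.rfl

/-! ### The monoid of a Turing machine -/

/-- The letters of the words that describe configurations of a Turing machine: tape symbols, states,
a letter that stands for a halted machine, and the right end marker. -/
inductive Letter (Γ Λ : Type) : Type
  | tape (a : Γ) : Letter Γ Λ
  | state (q : Λ) : Letter Γ Λ
  | halted : Letter Γ Λ
  | endMark : Letter Γ Λ

namespace Letter

instance {Γ Λ : Type} [Finite Γ] [Finite Λ] : Finite (Letter Γ Λ) := by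
  refine Finite.of_surjective
    (fun x : (Γ ⊕ Λ) ⊕ Bool => match x with
      | Sum.inl (Sum.inl a) => Letter.tape a
      | Sum.inl (Sum.inr q) => Letter.state q
      | Sum.inr true => Letter.halted
      | Sum.inr false => Letter.endMark) ?_
  rintro (a | q | _ | _)
  exacts [⟨Sum.inl (Sum.inl a), rfl⟩, ⟨Sum.inl (Sum.inr q), rfl⟩, ⟨Sum.inr true, rfl⟩,
    ⟨Sum.inr false, rfl⟩]

end Letter

/-- The element reached from `x` by reading a word from left to right, where the letter `g` acts
as the function `f g`. -/
def runWord {G D : Type} (f : G → D → D) (w : List G) (x : D) : D := w.foldl (fun y g => f g y) x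

theorem runWord_append_singleton {G D : Type} (f : G → D → D) (p : List G) (g : G) (x : D) :
    runWord f (p ++ [g]) x = f g (runWord f p x) := by
  simp [runWord]

section Machine

variable {Γ Λ : Type} [Inhabited Γ] [Inhabited Λ] (M : TM0.Machine Γ Λ) (S : Set Λ)

theorem mk_nil_eq_mk_default {Γ : Type} [Inhabited Γ] :
    (ListBlank.mk [] : ListBlank Γ) = ListBlank.mk [default] :=
  Quotient.sound' (Or.inl ⟨1, rfl⟩)

/-- The defining relations of the monoid of a Turing machine: `MachineRel M S u v d` means that the
words `u` and `v ++ [d]` are equal. The word `L q R endMark` stands for the configuration in state `q`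
with `L` to the left of the head, and `R` to the right, starting with the scanned symbol. Only
the states in `S` are used. -/
inductive MachineRel : List (Letter Γ S) → List (Letter Γ S) → Letter Γ S → Prop
  /-- Blanks at the right end are irrelevant. -/
  | blank : MachineRel [.tape default, .endMark] [] .endMark
  | write (q : S) (a : Γ) (q' : S) (c : Γ) : M q a = some (q'.1, .write c) →
      MachineRel [.state q, .tape a] [.state q'] (.tape c)
  | right (q : S) (a : Γ) (q' : S) : M q a = some (q'.1, .move .right) →
      MachineRel [.state q, .tape a] [.tape a] (.state q')
  | left (q : S) (a : Γ) (q' : S) (c : Γ) : M q a = some (q'.1, .move .left) →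
      MachineRel [.tape c, .state q, .tape a] [.state q', .tape c] (.tape a)
  | halt (q : S) (a : Γ) : M q a = none → MachineRel [.state q, .tape a] [] .halted
  | absorbRight (c : Γ) : MachineRel [.halted, .tape c] [] .halted
  | absorbLeft (c : Γ) : MachineRel [.tape c, .halted] [] .halted

theorem MachineRel.length_le {u v : List (Letter Γ S)} {d : Letter Γ S}
    (h : MachineRel M S u v d) : u.length ≤ 3 ∧ v.length ≤ 3 := by
  cases h <;> simp

/-- The machine halts when started in the configuration `c`. -/
def Halts (c : TM0.Cfg Γ Λ) : Prop := (StateTransition.eval (TM0.step M) c).Dom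

theorem halts_of_step {c c' : TM0.Cfg Γ Λ} (h : TM0.step M c = some c') :
    Halts M c ↔ Halts M c' := by
  unfold Halts
  rw [StateTransition.reaches_eval (Relation.ReflTransGen.single h)]

theorem halts_of_step_none {c : TM0.Cfg Γ Λ} (h : TM0.step M c = none) : Halts M c :=
  Part.dom_iff_mem.2 ⟨c, StateTransition.mem_eval.2 ⟨Relation.ReflTransGen.refl, h⟩⟩

/-- The elements of the action that refutes the equation of a non-halting configuration with a
halted one: words read from the left are identified as far as the machine cannot tell them apart. -/
inductive Node (Γ : Type) [Inhabited Γ] : Type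
  /-- Only tape symbols have been read; `l` lists them, the last one first. -/
  | left (l : ListBlank Γ) : Node Γ
  /-- A state has been read; the machine halts if the rest of the tape is `r` with `P r`. -/
  | right (P : ListBlank Γ → Prop) : Node Γ
  /-- The word is complete and its configuration halts if `p`. Words that describe no configuration
  are treated as halting. -/
  | done (p : Prop) : Node Γ

/-- The action of the letters on the nodes. -/
def Node.move : Letter Γ S → Node Γ → Node Γ
  | .tape a, .left l => .left (l.cons a)
  | .tape a, .right P => .right fun r => P (r.cons a)
  | .state q, .left l => .right fun r => Halts M ⟨q.1, Tape.mk' l r⟩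
  | .halted, .left _ => .right fun _ => True
  | .endMark, .right P => .done (P (ListBlank.mk []))
  | _, _ => .done True

/-- The action on nodes satisfies the relations of the machine, because a configuration halts if
and only if its successor does. -/
theorem Node.move_rel {u v : List (Letter Γ S)} {d : Letter Γ S} (h : MachineRel M S u v d)
    (y : Node Γ) :
    runWord (Node.move M S) u y = Node.move M S d (runWord (Node.move M S) v y) := by
  have hblank : (ListBlank.mk [] : ListBlank Γ).cons default = ListBlank.mk [] := by
    rw [ListBlank.cons_mk]
    exact mk_nil_eq_mk_default.symm
  cases h with
  | blank => rcases y with l | P | p <;> simp [runWord, Node.move, hblank]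
  | write q a q' c hM =>
    rcases y with l | P | p <;> simp only [runWord, List.foldl, Node.move]
    congr 1; funext r
    refine propext (halts_of_step M ?_)
    simp [TM0.step, hM]
  | right q a q' hM =>
    rcases y with l | P | p <;> simp only [runWord, List.foldl, Node.move]
    congr 1; funext r
    refine propext (halts_of_step M ?_)
    simp [TM0.step, hM]
  | left q a q' c hM =>
    rcases y with l | P | p <;> simp only [runWord, List.foldl, Node.move]
    congr 1; funext r
    refine propext (halts_of_step M ?_)
    simp [TM0.step, hM]
  | halt q a hM =>
    rcases y with l | P | p <;> simp only [runWord, List.foldl, Node.move]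
    congr 1; funext r
    refine eq_true (halts_of_step_none M ?_)
    simp [TM0.step, hM]
  | absorbRight c => rcases y with l | P | p <;> simp [runWord, Node.move]
  | absorbLeft c => rcases y with l | P | p <;> simp [runWord, Node.move]

variable {M S}

section Action

variable {D : Type} {f : Letter Γ S → D → D} {x : D}

/-- The element reached from `x` by the word of a configuration with the list `L` to the left of the
head (nearest symbol first), state `q`, and `R` on the rest of the tape. -/
def configNode (f : Letter Γ S → D → D) (x : D) (L : List Γ) (q : S) (R : List Γ) : D :=
  runWord f (R.map .tape ++ [.endMark]) (f (.state q) (L.foldr (fun a y => f (.tape a) y) x))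

/-- The letter for a halted machine absorbs the tape on both sides. -/
theorem runWord_halted
    (hf : ∀ u v d, MachineRel M S u v d → ∀ y, runWord f u y = f d (runWord f v y))
    (L R : List Γ) :
    runWord f (R.map .tape ++ [.endMark]) (f .halted (L.foldr (fun a y => f (.tape a) y) x)) =
      f .endMark (f .halted x) := by
  have hL : f .halted (L.foldr (fun a y => f (.tape a) y) x) = f .halted x := by
    induction L with
    | nil => rfl
    | cons c L ih => exact (hf _ _ _ (.absorbLeft c) _).trans ih
  rw [hL]
  induction R with
  | nil => rfl
  | cons c R ih =>
    have h := hf _ _ _ (.absorbRight c) x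
    simp only [runWord, List.foldl] at h
    simpa [runWord, h] using ih

/-- In an action that satisfies the relations of the machine, the words of a configuration that
halts and of the halted configuration act in the same way on an element fixed by the blank. -/
theorem configNode_of_halts (hS : TM0.Supports M S)
    (hf : ∀ u v d, MachineRel M S u v d → ∀ y, runWord f u y = f d (runWord f v y))
    (hx : f (.tape default) x = x) {q : S} {L R : List Γ}
    (h : Halts M ⟨q.1, Tape.mk' (ListBlank.mk L) (ListBlank.mk R)⟩) :
    configNode f x L q R = f .endMark (f .halted x) := by
  obtain ⟨c', hc'⟩ := Part.dom_iff_mem.1 h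
  obtain ⟨hreach, hend⟩ := StateTransition.mem_eval.1 hc'
  -- Both halves of the tape may be assumed non-empty, by adding blanks: on the left `x` is fixed by
  -- the blank, on the right there is a relation.
  have hR : ∀ R : List Γ, ∃ a R', (ListBlank.mk R : ListBlank Γ) = ListBlank.mk (a :: R') ∧
      ∀ (L : List Γ) (q : S), configNode f x L q R = configNode f x L q (a :: R') := by
    rintro (_ | ⟨a, R⟩)
    · refine ⟨default, [], mk_nil_eq_mk_default, fun L q => ?_⟩
      exact (hf _ _ _ .blank _).symm
    · exact ⟨a, R, rfl, fun _ _ => rfl⟩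
  have hL : ∀ L : List Γ, ∃ c L', (ListBlank.mk L : ListBlank Γ) = ListBlank.mk (c :: L') ∧
      ∀ (R : List Γ) (q : S), configNode f x L q R = configNode f x (c :: L') q R := by
    rintro (_ | ⟨c, L⟩)
    · refine ⟨default, [], mk_nil_eq_mk_default, fun R q => ?_⟩
      simp [configNode, hx]
    · exact ⟨c, L, rfl, fun _ _ => rfl⟩
  suffices H : ∀ c : TM0.Cfg Γ Λ, StateTransition.Reaches (TM0.step M) c c' →
      ∀ (q : S) (L R : List Γ), c = ⟨q.1, Tape.mk' (ListBlank.mk L) (ListBlank.mk R)⟩ →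
        configNode f x L q R = f .endMark (f .halted x) from H _ hreach q L R rfl
  intro c hc
  induction hc using Relation.ReflTransGen.head_induction_on with
  | refl =>
    intro q L R hcfg
    obtain ⟨a, R, hmk, hrw⟩ := hR R
    rw [hrw]
    rw [hmk] at hcfg
    subst hcfg
    have hM : M q a = none := by simpa [TM0.step] using hend
    have h1 := hf _ _ _ (.halt q a hM) (L.foldr (fun a y => f (.tape a) y) x)
    simp only [runWord, List.foldl] at h1
    have h2 := runWord_halted (x := x) hf L R
    rw [← h1] at h2
    exact h2
  | head hstep _ ih =>
    intro q L R hcfg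
    obtain ⟨a, R, hmk, hrw⟩ := hR R
    rw [hrw]
    rw [hmk] at hcfg
    subst hcfg
    obtain ⟨⟨q', s⟩, hM, hs⟩ := Option.map_eq_some_iff.1 (Option.mem_def.1 hstep)
    have hM : M q a = some (q', s) := by simpa using hM
    have hq' : q' ∈ S := hS.2 hM q.2
    rcases s with (_ | _) | b
    · obtain ⟨c, L, hmk', hrw'⟩ := hL L
      rw [hrw', ← ih ⟨q', hq'⟩ L (c :: a :: R) (by rw [← hs, hmk']; simp)]
      have h1 := hf _ _ _ (.left q a ⟨q', hq'⟩ c hM) (L.foldr (fun a y => f (.tape a) y) x)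
      exact congrArg (runWord f (R.map .tape ++ [.endMark])) h1
    · rw [← ih ⟨q', hq'⟩ (a :: L) R (by rw [← hs]; simp)]
      have h1 := hf _ _ _ (.right q a ⟨q', hq'⟩ hM) (L.foldr (fun a y => f (.tape a) y) x)
      exact congrArg (runWord f (R.map .tape ++ [.endMark])) h1
    · rw [← ih ⟨q', hq'⟩ L (b :: R) (by rw [← hs]; simp)]
      have h1 := hf _ _ _ (.write q a ⟨q', hq'⟩ b hM) (L.foldr (fun a y => f (.tape a) y) x)
      exact congrArg (runWord f (R.map .tape ++ [.endMark])) h1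

end Action

/-- The word of the initial configuration on the input `l`. -/
def inputWord (hS : TM0.Supports M S) (l : List Γ) : List (Letter Γ S) :=
  .state ⟨default, hS.1⟩ :: (l.map .tape ++ [.endMark])

/-- The machine runs forever on the input `l` if and only if the relations of the machine have an
action in which the words of the initial and of the halted configuration act differently. -/
theorem not_eval_dom_iff_exists_action (hS : TM0.Supports M S) (l : List Γ) :
    ¬ (TM0.eval M l).Dom ↔
      ∃ (D : Type) (f : Letter Γ S → D → D) (x : D),
        (∀ u v d, MachineRel M S u v d → ∀ y, runWord f u y = f d (runWord f v y)) ∧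
        f (.tape default) x = x ∧
        ∀ y, runWord f (inputWord hS l) x ≠ f .endMark (f .halted y) := by
  have hdom : (TM0.eval M l).Dom ↔
      Halts M ⟨default, Tape.mk' (ListBlank.mk []) (ListBlank.mk l)⟩ := Iff.rfl
  rw [hdom]
  constructor
  · intro h
    refine ⟨Node Γ, Node.move M S, .left (ListBlank.mk []), fun u v d huv y =>
      Node.move_rel M S huv y, ?_, ?_⟩
    · exact congrArg Node.left mk_nil_eq_mk_default.symm
    · have hrun : ∀ (l : List Γ) (P : ListBlank Γ → Prop),
          runWord (Node.move M S) (l.map .tape ++ [.endMark]) (.right P) =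
            .done (P (ListBlank.mk l)) := by
        intro l
        induction l with
        | nil => intro P; rfl
        | cons a l ih =>
          intro P
          exact ih _
      intro y hy
      have h1 : runWord (Node.move M S) (inputWord hS l) (.left (ListBlank.mk [])) =
          .done (Halts M ⟨default, Tape.mk' (ListBlank.mk []) (ListBlank.mk l)⟩) := hrun l _
      have h2 : Node.move M S .endMark (Node.move M S .halted y) = .done True := by
        rcases y with l | P | p <;> rfl
      rw [h1, h2, Node.done.injEq] at hy
      exact h (of_eq_true hy)
  · rintro ⟨D, f, x, hf, hx, hne⟩ h
    exact hne x (configNode_of_halts (L := []) hS hf hx (q := ⟨default, hS.1⟩) h)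

end Machine

/-! ### Models of a frontier-one rule as monoid actions -/

section Action

variable {G : Type} [Encodable G]

/-- The variable that names the element reached by the word `p` from the frontier variable. -/
def wordVar (p : List G) : ℕ := Encodable.encode p

/-- The atoms of the path that reads `w`, starting at the variable of the word `p`. -/
def pathAtoms : List G → List G → List Atom
  | _, [] => []
  | p, g :: w => (Encodable.encode g, [wordVar p, wordVar (p ++ [g])]) :: pathAtoms (p ++ [g]) w

/-- The atoms for a relation `(u, v, d)`: reading `u` from the frontier variable leads to the same
element as reading `v`, then `d`. -/
def relationAtoms (ρ : List G × List G × G) : List Atom :=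
  pathAtoms [] ρ.1 ++ pathAtoms [] ρ.2.1 ++ [(Encodable.encode ρ.2.2, [wordVar ρ.2.1, wordVar ρ.1])]

/-- The rule which says that every letter has a successor and that the relations hold, at every
element of the concept with name `1`. Each letter is a role. -/
def actionRule (gens : List G) (rels : List (List G × List G × G)) : Rule :=
  ([(1, [wordVar ([] : List G)])],
    gens.flatMap (fun g => pathAtoms [] [g]) ++ rels.flatMap relationAtoms)

/-- The letters as roles, and the concept names `0` for the end of an input and `1` for the
elements to which the rule applies. -/
def actionSignature (gens : List G) : Finset RelSymbol :=
  insert (0, 1) (insert (1, 1) (gens.map fun g => (Encodable.encode g, 2)).toFinset)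

/-- The path that reads `w` from the variable `w.length` to the variable `0`. -/
def chainAtoms : List ℕ → List Atom
  | [] => []
  | c :: w => (c, [w.length + 1, w.length]) :: chainAtoms w

/-- The fact for an input word: a path that reads `w`, has a loop `b` at its beginning and ends in
the concept with name `0`. The loop stands for the blanks to the left of the input. -/
def wordFact (b : ℕ) (w : List ℕ) : Fact :=
  (b, [w.length, w.length]) :: (0, [0]) :: chainAtoms w

/-- The query for an end of an input that is reached by reading `z`, then `e`. -/
def forbiddenQuery (z e : G) : BCQ :=
  [(Encodable.encode z, [0, 1]), (Encodable.encode e, [1, 2]), (0, [2])]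

/-- What the constraints have to express: all elements are in the concept `1`, the letters are
functional, and the ends of inputs are not reached by reading `z`, then `e`. -/
structure Interpretation.ActionConstraint {D : Type} (I : Interpretation D) (z e : G) : Prop where
  total : ∀ d, [d] ∈ I.rel 1
  funct : ∀ (g : G) (d d' d'' : D), [d, d'] ∈ I.rel (Encodable.encode g) →
    [d, d''] ∈ I.rel (Encodable.encode g) → d' = d''
  forbidden : ∀ d d' d'', [d, d'] ∈ I.rel (Encodable.encode z) →
    [d', d''] ∈ I.rel (Encodable.encode e) → [d''] ∉ I.rel 0

theorem actionRule_frontier (gens : List G) (rels : List (List G × List G × G)) (g : G)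
    (hg : g ∈ gens) : Rule.frontier (actionRule gens rels) = {wordVar ([] : List G)} := by
  refine Finset.Subset.antisymm (fun x hx => ?_) (fun x hx => ?_)
  · simpa [conjVars, actionRule, Atom.vars] using (Finset.mem_inter.1 hx).1
  · rw [Finset.mem_singleton] at hx
    subst hx
    refine Finset.mem_inter.2 ⟨by simp [conjVars, actionRule, Atom.vars], ?_⟩
    refine Finset.mem_biUnion.2 ⟨(Encodable.encode g, [wordVar ([] : List G),
      wordVar ([] ++ [g])]), ?_, ?_⟩
    · refine List.mem_toFinset.2 (List.mem_append_left _ (List.mem_flatMap.2 ⟨g, hg, ?_⟩))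
      simp [pathAtoms]
    · simp [Atom.vars]

theorem actionRule_frontierOne (gens : List G) (rels : List (List G × List G × G)) (g : G)
    (hg : g ∈ gens) : Rule.FrontierOne (actionRule gens rels) := by
  rw [Rule.FrontierOne, actionRule_frontier gens rels g hg, Finset.card_singleton]

theorem mem_actionSignature {gens : List G} {g : G} (hg : g ∈ gens) :
    (Encodable.encode g, 2) ∈ actionSignature gens := by
  simp only [actionSignature, Finset.mem_insert, List.mem_toFinset, List.mem_map]
  exact Or.inr (Or.inr ⟨g, hg, rfl⟩)

theorem conjOver_pathAtoms {gens : List G} (hgens : ∀ g, g ∈ gens) (p w : List G) :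
    conjOver (actionSignature gens) (pathAtoms p w) := by
  induction w generalizing p with
  | nil => simp [conjOver, pathAtoms]
  | cons g w ih =>
    refine List.forall_mem_cons.2 ⟨mem_actionSignature (hgens g), ih _⟩

theorem actionRule_over {gens : List G} (hgens : ∀ g, g ∈ gens)
    (rels : List (List G × List G × G)) :
    Rule.Over (actionSignature gens) (actionRule gens rels) := by
  refine ⟨by simp [conjOver, actionRule, actionSignature, Atom.symbol], fun a ha => ?_⟩
  rcases List.mem_append.1 ha with ha | ha <;> obtain ⟨g, -, ha⟩ := List.mem_flatMap.1 ha
  · exact conjOver_pathAtoms hgens _ _ a ha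
  · rcases List.mem_append.1 ha with ha | ha
    · rcases List.mem_append.1 ha with ha | ha <;> exact conjOver_pathAtoms hgens _ _ a ha
    · rw [List.mem_singleton.1 ha]
      exact mem_actionSignature (hgens _)

theorem conjOver_chainAtoms {gens : List G} (hgens : ∀ g, g ∈ gens) (w : List G) :
    conjOver (actionSignature gens) (chainAtoms (w.map Encodable.encode)) := by
  induction w with
  | nil => simp [conjOver, chainAtoms]
  | cons g w ih => exact List.forall_mem_cons.2 ⟨mem_actionSignature (hgens g), ih⟩

theorem conjOver_wordFact {gens : List G} (hgens : ∀ g, g ∈ gens) (b : G) (w : List G) :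
    conjOver (actionSignature gens) (wordFact (Encodable.encode b) (w.map Encodable.encode)) :=
  List.forall_mem_cons.2 ⟨mem_actionSignature (hgens b), List.forall_mem_cons.2
    ⟨by simp [actionSignature, Atom.symbol], conjOver_chainAtoms hgens w⟩⟩

theorem conjOver_forbiddenQuery {gens : List G} (hgens : ∀ g, g ∈ gens) (z e : G) :
    conjOver (actionSignature gens) (forbiddenQuery z e) :=
  List.forall_mem_cons.2 ⟨mem_actionSignature (hgens z), List.forall_mem_cons.2
    ⟨mem_actionSignature (hgens e), by simp [actionSignature, Atom.symbol]⟩⟩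

theorem actionSignature_arity (gens : List G) :
    ∀ R ∈ actionSignature gens, R.2 = 1 ∨ R.2 = 2 := by
  intro R hR
  simp only [actionSignature, Finset.mem_insert, List.mem_toFinset, List.mem_map] at hR
  rcases hR with rfl | rfl | ⟨g, -, rfl⟩ <;> simp

/-- Reading a path under a valuation: the letters being functions, the end of the path is
determined by its beginning. -/
theorem eval_pathAtoms {D : Type} {I : Interpretation D} {f : G → D → D}
    (hf : ∀ g d d', [d, d'] ∈ I.rel (Encodable.encode g) → d' = f g d) {v : ℕ → D} (p w : List G)
    (h : ∀ a ∈ pathAtoms p w, I.Holds v a) :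
    v (wordVar (p ++ w)) = runWord f w (v (wordVar p)) := by
  induction w generalizing p with
  | nil => simp [runWord]
  | cons g w ih =>
    obtain ⟨h1, h2⟩ := List.forall_mem_cons.1 h
    have h3 := ih _ h2
    rw [List.append_assoc] at h3
    rw [show p ++ g :: w = p ++ ([g] ++ w) from rfl, h3, hf _ _ _ h1]
    rfl

theorem eval_chainAtoms {D : Type} {I : Interpretation D} {f : G → D → D}
    (hf : ∀ g d d', [d, d'] ∈ I.rel (Encodable.encode g) → d' = f g d) {v : ℕ → D} (w : List G)
    (h : ∀ a ∈ chainAtoms (w.map Encodable.encode), I.Holds v a) :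
    v 0 = runWord f w (v w.length) := by
  induction w with
  | nil => simp [runWord]
  | cons g w ih =>
    obtain ⟨h1, h2⟩ := List.forall_mem_cons.1 h
    have h3 : v w.length = f g (v (w.length + 1)) := by simpa using hf g _ _ h1
    rw [ih h2, h3]
    rfl

/-- In a model of the rule and the constraints, the letters act as functions that satisfy the
relations. -/
theorem exists_action_of_model {gens : List G} (hgens : ∀ g, g ∈ gens)
    {rels : List (List G × List G × G)} {z e : G} {D : Type} {I : Interpretation D}
    (hrule : I.SatRule (actionRule gens rels)) (hI : I.ActionConstraint z e) :
    ∃ f : G → D → D, (∀ g d d', [d, d'] ∈ I.rel (Encodable.encode g) ↔ d' = f g d) ∧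
      ∀ ρ ∈ rels, ∀ y, runWord f ρ.1 y = f ρ.2.2 (runWord f ρ.2.1 y) := by
  have key : ∀ y, ∃ w : ℕ → D, w (wordVar ([] : List G)) = y ∧
      ∀ a ∈ (actionRule gens rels).2, I.Holds w a := by
    intro y
    obtain ⟨w, hw, hw'⟩ := hrule (fun _ => y)
      (List.forall_mem_singleton.2 (hI.total y))
    refine ⟨w, hw _ ?_, hw'⟩
    rw [actionRule_frontier gens rels z (hgens z)]
    exact Finset.mem_singleton_self _
  have hex : ∀ (g : G) (y : D), ∃ y', [y, y'] ∈ I.rel (Encodable.encode g) := by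
    intro g y
    obtain ⟨w, rfl, hw⟩ := key y
    refine ⟨w (wordVar ([] ++ [g])), hw (Encodable.encode g, [wordVar [], wordVar ([] ++ [g])])
      (List.mem_append_left _ (List.mem_flatMap.2 ⟨g, hgens g, ?_⟩))⟩
    simp [pathAtoms]
  choose f hf using hex
  have hf' : ∀ g d d', [d, d'] ∈ I.rel (Encodable.encode g) → d' = f g d :=
    fun g d d' h => hI.funct g d _ _ h (hf g d)
  refine ⟨f, fun g d d' => ⟨hf' g d d', fun h => h ▸ hf g d⟩, fun ρ hρ y => ?_⟩
  obtain ⟨w, rfl, hw⟩ := key y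
  have hw' : ∀ a ∈ relationAtoms ρ, I.Holds w a := fun a ha =>
    hw a (List.mem_append_right _ (List.mem_flatMap.2 ⟨ρ, hρ, ha⟩))
  have h1 := eval_pathAtoms hf' [] ρ.1
    fun a ha => hw' a (List.mem_append_left _ (List.mem_append_left _ ha))
  have h2 := eval_pathAtoms hf' [] ρ.2.1
    fun a ha => hw' a (List.mem_append_left _ (List.mem_append_right _ ha))
  have h3 := hf' ρ.2.2 _ _ (hw' _ (List.mem_append_right _ (List.mem_singleton_self _)))
  rw [List.nil_append] at h1 h2
  rw [← h1, ← h2, h3]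

/-- The interpretation given by an action of the letters and the set `A` of ends of inputs. -/
def actionInterpretation {D : Type} (f : G → D → D) (A : Set D) : Interpretation D where
  rel r := {t | (∃ g d, Encodable.encode g = r ∧ t = [d, f g d]) ∨ (r = 0 ∧ ∃ d ∈ A, t = [d]) ∨
    (r = 1 ∧ ∃ d, t = [d])}

theorem actionInterpretation_role {D : Type} (f : G → D → D) (A : Set D) (g : G) (d d' : D) :
    [d, d'] ∈ (actionInterpretation f A).rel (Encodable.encode g) ↔ d' = f g d := by
  simp only [actionInterpretation, Set.mem_ofPred_eq]
  constructor
  · rintro (⟨g', y, hg, h⟩ | ⟨-, y, -, h⟩ | ⟨-, y, h⟩)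
    · cases Encodable.encode_injective hg
      simp only [List.cons.injEq, and_true] at h
      rw [h.2, h.1]
    · simp at h
    · simp at h
  · rintro rfl
    exact Or.inl ⟨g, d, rfl, rfl⟩

theorem actionInterpretation_end {D : Type} (f : G → D → D) (A : Set D) (d : D) :
    [d] ∈ (actionInterpretation f A).rel 0 ↔ d ∈ A := by
  simp [actionInterpretation]

theorem actionInterpretation_constraint {D : Type} {f : G → D → D} {A : Set D} {z e : G}
    (hA : ∀ y, f e (f z y) ∉ A) : (actionInterpretation f A).ActionConstraint z e where
  total d := Or.inr (Or.inr ⟨rfl, d, rfl⟩)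
  funct g d d' d'' h h' := by
    rw [actionInterpretation_role] at h h'
    rw [h, h']
  forbidden d d' d'' h h' := by
    rw [actionInterpretation_role] at h h'
    rw [actionInterpretation_end, h', h]
    exact hA d

theorem actionInterpretation_pathAtoms {D : Type} (f : G → D → D) (A : Set D) {v : ℕ → D}
    {x : D} (hv : ∀ p : List G, v (wordVar p) = runWord f p x) (p w : List G) :
    ∀ a ∈ pathAtoms p w, (actionInterpretation f A).Holds v a := by
  induction w generalizing p with
  | nil => simp [pathAtoms]
  | cons g w ih =>
    refine List.forall_mem_cons.2 ⟨?_, ih _⟩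
    refine (actionInterpretation_role f A g _ _).2 ?_
    rw [hv, hv, runWord_append_singleton]

theorem actionInterpretation_rule {gens : List G} {rels : List (List G × List G × G)} {g : G}
    (hg : g ∈ gens) {D : Type} {f : G → D → D} (A : Set D)
    (hf : ∀ ρ ∈ rels, ∀ y, runWord f ρ.1 y = f ρ.2.2 (runWord f ρ.2.1 y)) :
    (actionInterpretation f A).SatRule (actionRule gens rels) := by
  intro v _
  let x := v (wordVar ([] : List G))
  -- The variable of a word is mapped to the element reached by reading it.
  let w : ℕ → D := fun n => runWord f ((Encodable.decode n : Option (List G)).getD []) x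
  have hw : ∀ p : List G, w (wordVar p) = runWord f p x := fun p => by
    simp [w, wordVar, Encodable.encodek]
  refine ⟨w, fun y hy => ?_, fun a ha => ?_⟩
  · rw [actionRule_frontier gens rels g hg, Finset.mem_singleton] at hy
    rw [hy, hw]
    rfl
  · rcases List.mem_append.1 ha with ha | ha
    · obtain ⟨g, -, ha⟩ := List.mem_flatMap.1 ha
      exact actionInterpretation_pathAtoms f A hw _ _ a ha
    · obtain ⟨ρ, hρ, ha⟩ := List.mem_flatMap.1 ha
      rcases List.mem_append.1 ha with ha | ha
      · rcases List.mem_append.1 ha with ha | ha <;>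
          exact actionInterpretation_pathAtoms f A hw _ _ a ha
      · rw [List.mem_singleton.1 ha]
        refine (actionInterpretation_role f A _ _ _).2 ?_
        rw [hw, hw, hf ρ hρ]

theorem actionInterpretation_chainAtoms {D : Type} (f : G → D → D) (A : Set D) (v : ℕ → D)
    (w : List G) (hv : ∀ g w', g :: w' <:+ w → v w'.length = f g (v (w'.length + 1))) :
    ∀ a ∈ chainAtoms (w.map Encodable.encode), (actionInterpretation f A).Holds v a := by
  induction w with
  | nil => simp [chainAtoms]
  | cons g w ih =>
    refine List.forall_mem_cons.2 ⟨?_, ih fun g' w' h =>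
      hv g' w' (h.trans (List.suffix_cons g w))⟩
    refine (actionInterpretation_role f A g _ _).2 ?_
    simpa using hv g w List.suffix_rfl

theorem actionInterpretation_wordFact {D : Type} {f : G → D → D} {A : Set D} {b : G} {x : D}
    (hx : f b x = x) {w : List G} (hw : runWord f w x ∈ A) :
    (actionInterpretation f A).SatConj
      (wordFact (Encodable.encode b) (w.map Encodable.encode)) := by
  -- The variable `i` is mapped to the element reached when `i` letters are still to be read.
  refine ⟨fun i => runWord f (w.take (w.length - i)) x, List.forall_mem_cons.2 ⟨?_,
    List.forall_mem_cons.2 ⟨?_, ?_⟩⟩⟩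
  · refine (actionInterpretation_role f A b _ _).2 ?_
    simp [runWord, hx]
  · refine (actionInterpretation_end f A _).2 ?_
    simpa using hw
  · refine actionInterpretation_chainAtoms f A _ w ?_
    rintro g w' ⟨t, rfl⟩
    have h1 : (t ++ g :: w').length - w'.length = (t ++ [g]).length := by
      simp only [List.length_append, List.length_cons, List.length_nil]
      omega
    have h2 : (t ++ g :: w').length - (w'.length + 1) = t.length := by simp
    simp only [h1, h2]
    rw [List.take_left, show t ++ g :: w' = (t ++ [g]) ++ w' by simp, List.take_left,
      runWord_append_singleton]

variable {L : Type} {sat : ∀ {D : Type}, Interpretation D → L → Prop}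

/-- The constraints `Γ` express that the letters are functional, and that no input ends where the
word `z e` leads. -/
def ExpressAction (sat : ∀ {D : Type}, Interpretation D → L → Prop) (Γ : List L) (z e : G) : Prop :=
  ∀ (D : Type) (_ : Nonempty D) (I : Interpretation D),
    (∀ c ∈ Γ, sat I c) ↔ I.ActionConstraint z e

/-- The models of the rule and the constraints are the actions of the monoid given by the
relations. -/
theorem satisfiable_iff_exists_action {gens : List G} (hgens : ∀ g, g ∈ gens)
    {rels : List (List G × List G × G)} {b z e : G} {Γ : List L}
    (hΓ : ExpressAction sat Γ z e) (w : List G) :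
    Satisfiable sat (wordFact (Encodable.encode b) (w.map Encodable.encode))
        [actionRule gens rels] Γ ↔
      ∃ (D : Type) (f : G → D → D) (x : D),
        (∀ ρ ∈ rels, ∀ y, runWord f ρ.1 y = f ρ.2.2 (runWord f ρ.2.1 y)) ∧ f b x = x ∧
        ∀ y, runWord f w x ≠ f e (f z y) := by
  constructor
  · rintro ⟨D, hD, I, ⟨v, hv⟩, hrule, hI⟩
    have hI' := (hΓ D hD I).1 hI
    obtain ⟨f, hf, hrel⟩ := exists_action_of_model hgens (hrule _ (List.mem_singleton_self _)) hI'
    obtain ⟨h1, hv⟩ := List.forall_mem_cons.1 hv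
    obtain ⟨h2, h3⟩ := List.forall_mem_cons.1 hv
    refine ⟨D, f, v w.length, hrel, ?_, fun y hy => ?_⟩
    · simpa using ((hf b _ _).1 h1).symm
    · have hend := eval_chainAtoms (fun g d d' => (hf g d d').1) w h3
      refine hI'.forbidden y (f z y) (v 0) ((hf _ _ _).2 rfl) ((hf _ _ _).2 ?_) h2
      rw [hend, hy]
  · rintro ⟨D, f, x, hrel, hx, hne⟩
    have hA : ∀ y, f e (f z y) ∉ ({runWord f w x} : Set D) := fun y hy => hne y hy.symm
    refine ⟨D, ⟨x⟩, actionInterpretation f {runWord f w x}, actionInterpretation_wordFact hx rfl,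
      List.forall_mem_singleton.2 (actionInterpretation_rule (hgens z) _ hrel), ?_⟩
    exact (hΓ D ⟨x⟩ _).2 (actionInterpretation_constraint hA)

/-- The query contradicts the constraints, so that it is entailed only if there are no models. -/
theorem entails_forbiddenQuery_iff {z e : G} {Γ : List L} (hΓ : ExpressAction sat Γ z e)
    (F : Fact) (Δ : List Rule) :
    Entails sat F Δ Γ (forbiddenQuery z e) ↔ ¬ Satisfiable sat F Δ Γ := by
  constructor
  · rintro h ⟨D, hD, I, hF, hI⟩
    obtain ⟨v, hv⟩ := h D hD I hF hI
    simp only [forbiddenQuery, List.forall_mem_cons] at hv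
    exact ((hΓ D hD I).1 hI.2).forbidden (v 0) (v 1) (v 2) hv.1 hv.2.1 hv.2.2.1
  · intro h D hD I hF hI
    exact absurd ⟨D, hD, I, hF, hI⟩ h

/-! ### The constraints in `ALCF` and in `GC²` -/

/-- The constraints on actions, in `ALCF`. -/
def actionALCF (gens : List G) (z e : G) : List ALCFConstraint :=
  .incl .top (.name 1) ::
  .incl (.ex (Encodable.encode z) (.ex (Encodable.encode e) (.name 0))) .bot ::
  gens.map fun g => .funct (Encodable.encode g)

theorem expressAction_actionALCF {gens : List G} (hgens : ∀ g, g ∈ gens) (z e : G) :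
    ExpressAction satALCF (actionALCF gens z e) z e := by
  intro D _ I
  simp only [actionALCF, List.forall_mem_cons, List.forall_mem_map]
  constructor
  · rintro ⟨h1, h2, h3⟩
    exact ⟨fun d => h1 (Set.mem_univ d), fun g => h3 g (hgens g),
      fun d d' d'' hz he ha => h2 (a := d) ⟨d', hz, d'', he, ha⟩⟩
  · rintro ⟨h1, h2, h3⟩
    refine ⟨fun d _ => h1 d, ?_, fun g _ => h2 g⟩
    rintro d ⟨d', hz, d'', he, ha⟩
    exact (h3 d d' d'' hz he ha).elim

theorem actionALCF_symbols {gens : List G} (hgens : ∀ g, g ∈ gens) (z e : G) :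
    ∀ c ∈ actionALCF gens z e, c.symbols ⊆ actionSignature gens := by
  simp only [actionALCF, List.forall_mem_cons, List.forall_mem_map]
  refine ⟨?_, ?_, fun g hg => Finset.singleton_subset_iff.2 (mem_actionSignature hg)⟩
  · simp [ALCFConstraint.symbols, Concept.symbols, actionSignature]
  · have hz := mem_actionSignature (hgens z)
    have he := mem_actionSignature (hgens e)
    have h0 : ((0, 1) : RelSymbol) ∈ actionSignature gens := by simp [actionSignature]
    simp [ALCFConstraint.symbols, Concept.symbols, Finset.insert_subset_iff, hz, he, h0]

/-- The constraints on actions, in `GC²`. The trivial equality is there because a counting quantifier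
needs a formula besides its guard. -/
def actionGC2 (gens : List G) (z e : G) : List Formula :=
  .neg (.exGe 1 0 (.neg (.atom (1, [0])))) ::
  .neg (.exGe 1 0 (.exGe 1 1 (.and (.atom (Encodable.encode z, [0, 1]))
    (.exGe 1 0 (.and (.atom (Encodable.encode e, [1, 0])) (.atom (0, [0]))))))) ::
  gens.map fun g => .neg (.exGe 1 0 (.exGe 2 1 (.and (.atom (Encodable.encode g, [0, 1]))
    (.eq 0 0))))

theorem Formula.sat_exGe_one {D : Type} (I : Interpretation D) (i : ℕ) (φ : Formula)
    (v : ℕ → D) : Formula.Sat I (.exGe 1 i φ) v ↔ ∃ d, Formula.Sat I φ (Function.update v i d) := by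
  simp only [Formula.Sat]
  constructor
  · rintro ⟨s, hs, h⟩
    obtain ⟨d, rfl⟩ := Finset.card_eq_one.1 hs
    exact ⟨d, h d (Finset.mem_singleton_self d)⟩
  · rintro ⟨d, h⟩
    exact ⟨{d}, Finset.card_singleton d, by simpa using h⟩

theorem Formula.sat_exGe_two {D : Type} (I : Interpretation D) (i : ℕ) (φ : Formula)
    (v : ℕ → D) : Formula.Sat I (.exGe 2 i φ) v ↔ ∃ d d', d ≠ d' ∧
      Formula.Sat I φ (Function.update v i d) ∧ Formula.Sat I φ (Function.update v i d') := by
  classical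
  simp only [Formula.Sat]
  constructor
  · rintro ⟨s, hs, h⟩
    obtain ⟨d, d', hne, rfl⟩ := Finset.card_eq_two.1 hs
    exact ⟨d, d', hne, h d (by simp), h d' (by simp)⟩
  · rintro ⟨d, d', hne, h, h'⟩
    exact ⟨{d, d'}, Finset.card_pair hne, by simpa using ⟨h, h'⟩⟩

theorem expressAction_actionGC2 {gens : List G} (hgens : ∀ g, g ∈ gens) (z e : G) :
    ExpressAction satFO (actionGC2 gens z e) z e := by
  intro D hD I
  obtain ⟨d₀⟩ := hD
  simp only [actionGC2, List.forall_mem_cons, List.forall_mem_map, satFO, Formula.IsTrue]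
  have neg : ∀ (φ : Formula) (v : ℕ → D), Formula.Sat I (.neg φ) v ↔ ¬ Formula.Sat I φ v :=
    fun _ _ => Iff.rfl
  have and : ∀ (φ ψ : Formula) (v : ℕ → D),
      Formula.Sat I (.and φ ψ) v ↔ Formula.Sat I φ v ∧ Formula.Sat I ψ v := fun _ _ _ => Iff.rfl
  have atom : ∀ (a : Atom) (v : ℕ → D), Formula.Sat I (.atom a) v ↔ a.2.map v ∈ I.rel a.1 :=
    fun _ _ => Iff.rfl
  have eq : ∀ (i j : ℕ) (v : ℕ → D), Formula.Sat I (.eq i j) v ↔ v i = v j :=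
    fun _ _ _ => Iff.rfl
  simp only [neg, and, atom, eq, Formula.sat_exGe_one, Formula.sat_exGe_two]
  simp only [List.map_cons, List.map_nil, Function.update_self, ne_eq, one_ne_zero, zero_ne_one,
    not_false_eq_true, Function.update_of_ne, and_true, not_exists, not_not, not_and]
  have inst : Nonempty (ℕ → D) := ⟨fun _ => d₀⟩
  simp only [forall_const]
  constructor
  · rintro ⟨h1, h2, h3⟩
    refine ⟨h1, fun g d d' d'' h h' => ?_, fun d d' d'' hz => h2 d d' hz d''⟩
    by_contra hne
    exact h3 g (hgens g) d d' d'' hne h h'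
  · rintro ⟨h1, h2, h3⟩
    exact ⟨h1, fun d d' hz d'' => h3 d d' d'' hz, fun g _ d d' d'' hne h h' => hne (h2 g d d' d'' h h')⟩

theorem actionGC2_sentences {gens : List G} (hgens : ∀ g, g ∈ gens) (z e : G) :
    ∀ φ ∈ actionGC2 gens z e, φ.GC2Sentence ∧ φ.symbols ⊆ actionSignature gens := by
  have h0 : ((0, 1) : RelSymbol) ∈ actionSignature gens := by simp [actionSignature]
  have h1 : ((1, 1) : RelSymbol) ∈ actionSignature gens := by simp [actionSignature]
  have hg := fun g => mem_actionSignature (hgens g)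
  simp only [actionGC2, List.forall_mem_cons, List.forall_mem_map]
  refine ⟨⟨⟨?_, ?_⟩, ?_⟩, ⟨⟨?_, ?_⟩, ?_⟩, fun g _ => ⟨⟨?_, ?_⟩, ?_⟩⟩
  · exact .neg _ (.ex _ _ (by norm_num) (by decide) (.neg _ (.unary _ _ (by norm_num))))
  · decide
  · simpa [Formula.symbols, Atom.symbol] using h1
  · exact .neg _ (.ex _ _ (by norm_num) (by simp [Formula.freeVars, Atom.vars])
      (.guarded _ _ _ _ _ _ (by norm_num) (by norm_num) (by norm_num) (by norm_num)
        (.guarded _ _ _ _ _ _ (by norm_num) (by norm_num) (by norm_num) (by norm_num)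
          (.unary _ _ (by norm_num)))))
  · simp [Formula.freeVars, Atom.vars]
  · simp [Formula.symbols, Atom.symbol, Finset.insert_subset_iff, hg, h0]
  · exact .neg _ (.ex _ _ (by norm_num) (by simp [Formula.freeVars, Atom.vars])
      (.guarded _ _ _ _ _ _ (by norm_num) (by norm_num) (by norm_num) (by norm_num)
        (.eq _ _ (by norm_num) (by norm_num))))
  · simp [Formula.freeVars, Atom.vars]
  · simp [Formula.symbols, Atom.symbol, hg]

end Action

/-! ### Undecidability -/

/-- Decidability on instances is inherited along computable reductions. -/
theorem DecidableOn.of_reduction {α β : Type} [Primcodable α] [Primcodable β]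
    {inst p : α → Prop} {inst' p' : β → Prop} {g : α → β} (hg : Computable g)
    (h : ∀ x, inst x → inst' (g x) ∧ (p' (g x) ↔ p x)) (hd : DecidableOn inst' p') :
    DecidableOn inst p := by
  obtain ⟨f, hf, hfp⟩ := hd
  exact ⟨fun x => f (g x), hf.comp hg, fun x hx => (hfp _ (h x hx).1).trans (h x hx).2⟩

theorem DecidableOn.computablePred {α : Type} [Primcodable α] {p : α → Prop}
    (h : DecidableOn (fun _ => True) p) : ComputablePred p := by
  obtain ⟨f, hf, hfp⟩ := h
  exact ComputablePred.computable_iff.2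
    ⟨f, hf, funext fun x => propext (hfp x trivial).symm⟩

theorem primrec_chainAtoms : Primrec chainAtoms := by
  have h : Primrec fun w : List ℕ => (List.recOn w [] fun c w ih =>
      ((c, [w.length + 1, w.length]) : Atom) :: ih : List Atom) := by
    refine Primrec.list_rec (f := fun w : List ℕ => w) (g := fun _ => ([] : List Atom))
      (h := fun _ b => ((b.1, [b.2.1.length + 1, b.2.1.length]) : Atom) :: b.2.2)
      Primrec.id (Primrec.const _) ?_
    have hc : Primrec fun p : List ℕ × ℕ × List ℕ × List Atom => p.2.1 :=
      Primrec.fst.comp Primrec.snd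
    have hl : Primrec fun p : List ℕ × ℕ × List ℕ × List Atom => p.2.2.1.length :=
      Primrec.list_length.comp (Primrec.fst.comp (Primrec.snd.comp Primrec.snd))
    have hi : Primrec fun p : List ℕ × ℕ × List ℕ × List Atom => p.2.2.2 :=
      Primrec.snd.comp (Primrec.snd.comp Primrec.snd)
    exact Primrec.list_cons.comp (Primrec.pair hc (Primrec.list_cons.comp (Primrec.succ.comp hl)
      (Primrec.list_cons.comp hl (Primrec.const [])))) hi
  refine h.of_eq fun w => ?_
  induction w with
  | nil => rfl
  | cons c w ih => exact congrArg (List.cons _) ih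

theorem primrec_wordFact (b : ℕ) : Primrec (wordFact b) := by
  have h : Primrec fun w : List ℕ => ((b, [w.length, w.length]) : Atom) :=
    Primrec.pair (Primrec.const b) (Primrec.list_cons.comp Primrec.list_length
      (Primrec.list_cons.comp Primrec.list_length (Primrec.const [])))
  exact Primrec.list_cons.comp h (Primrec.list_cons.comp (Primrec.const _) primrec_chainAtoms)

/-- There is a finite presentation of a monoid for which satisfiability and query answering are
undecidable, in every logic that expresses the constraints on actions. -/
theorem exists_undecidable_presentation :
    ∃ (G : Type) (_ : Encodable G) (gens : List G) (rels : List (List G × List G × G)) (z e : G),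
      (∀ g, g ∈ gens) ∧
      ∀ (L : Type) (sat : ∀ {D : Type}, Interpretation D → L → Prop) (Γ : List L),
        ExpressAction sat Γ z e →
        ¬ DecidableOn (fun F : Fact => conjOver (actionSignature gens) F)
            (fun F => Satisfiable sat F [actionRule gens rels] Γ) ∧
        ¬ DecidableOn (fun F : Fact => conjOver (actionSignature gens) F)
            (fun F => Entails sat F [actionRule gens rels] Γ (forbiddenQuery z e)) := by
  obtain ⟨Γ₀, Λ, _, _, _, M, S, a, β, hSfin, hS, hM⟩ := exists_universal_machine
  have : Finite S := hSfin
  obtain ⟨inst⟩ := nonempty_encodable (Letter Γ₀ S)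
  obtain ⟨gens, hgens⟩ := Finite.exists_univ_list (Letter Γ₀ S)
  -- Only words of length at most three occur in the relations.
  have hfin : {ρ : List (Letter Γ₀ S) × List (Letter Γ₀ S) × Letter Γ₀ S |
      MachineRel M S ρ.1 ρ.2.1 ρ.2.2}.Finite := by
    refine ((List.finite_length_le _ 3).prod
      ((List.finite_length_le _ 3).prod Set.finite_univ)).subset fun ρ hρ => ?_
    exact ⟨hρ.length_le.1, hρ.length_le.2, trivial⟩
  refine ⟨Letter Γ₀ S, inst, gens, hfin.toFinset.toList, .halted, .endMark, hgens.2,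
    fun L sat Γ hΓ => ?_⟩
  let F : List Bool → Fact := fun s =>
    wordFact (Encodable.encode (Letter.tape default : Letter Γ₀ S))
      ((inputWord hS (a :: s.map β)).map Encodable.encode)
  have hF : Computable F := by
    have h1 : Primrec fun s : List Bool =>
        s.map fun x => Encodable.encode (Letter.tape (β x) : Letter Γ₀ S) :=
      Primrec.list_map Primrec.id ((Primrec.dom_finite fun x : Bool =>
        Encodable.encode (Letter.tape (β x) : Letter Γ₀ S)).comp Primrec.snd)
    have h2 := (primrec_wordFact (Encodable.encode (Letter.tape default : Letter Γ₀ S))).comp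
      (Primrec.list_cons.comp
        (Primrec.const (Encodable.encode (Letter.state ⟨default, hS.1⟩ : Letter Γ₀ S)))
        (Primrec.list_cons.comp (Primrec.const (Encodable.encode (Letter.tape a : Letter Γ₀ S)))
          (Primrec.list_append.comp h1
            (Primrec.const [Encodable.encode (Letter.endMark : Letter Γ₀ S)]))))
    refine (h2.of_eq fun s => ?_).to_comp
    simp [F, inputWord, Function.comp_def]
  have hover : ∀ s, conjOver (actionSignature gens) (F s) := fun s =>
    conjOver_wordFact hgens.2 _ _
  have hsat : ∀ s, Satisfiable sat (F s) [actionRule gens hfin.toFinset.toList] Γ ↔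
      ¬ (TM0.eval M (a :: s.map β)).Dom := by
    intro s
    rw [not_eval_dom_iff_exists_action hS, satisfiable_iff_exists_action hgens.2 hΓ]
    simp only [Finset.mem_toList, Set.Finite.mem_toFinset, Prod.forall]
    rfl
  constructor
  · intro hd
    refine hM ?_
    have h := (DecidableOn.of_reduction (inst := fun _ => True) hF
      (fun s _ => ⟨hover s, hsat s⟩) hd).computablePred.not
    simpa only [not_not] using h
  · intro hd
    refine hM (DecidableOn.of_reduction (inst := fun _ => True) hF
      (fun s _ => ⟨hover s, ?_⟩) hd).computablePred
    rw [entails_forbiddenQuery_iff hΓ, hsat, not_not]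

end DLRules


theorem mainTheorem1 :
    -- fixed constraints in `ALCF` and a fixed single rule; only the fact is the input
    (∃ (σ : Finset DLRules.RelSymbol) (τ : DLRules.Rule) (Γ : List DLRules.ALCFConstraint)
        (q : DLRules.BCQ),
      (∀ R ∈ σ, R.2 = 1 ∨ R.2 = 2) ∧
      DLRules.Rule.Over σ τ ∧ (∀ c ∈ Γ, c.symbols ⊆ σ) ∧ DLRules.conjOver σ q ∧
      DLRules.Rule.FrontierOne τ ∧
      ¬ DLRules.DecidableOn (fun F : DLRules.Fact => DLRules.conjOver σ F)
          (fun F => DLRules.Satisfiable DLRules.satALCF F [τ] Γ) ∧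
      ¬ DLRules.DecidableOn (fun F : DLRules.Fact => DLRules.conjOver σ F)
          (fun F => DLRules.Entails DLRules.satALCF F [τ] Γ q)) ∧
    -- the same with fixed constraints in `GC²`
    (∃ (σ : Finset DLRules.RelSymbol) (τ : DLRules.Rule) (Γ : List DLRules.Formula)
        (q : DLRules.BCQ),
      (∀ R ∈ σ, R.2 = 1 ∨ R.2 = 2) ∧
      DLRules.Rule.Over σ τ ∧ (∀ φ ∈ Γ, φ.GC2Sentence ∧ φ.symbols ⊆ σ) ∧
      DLRules.conjOver σ q ∧
      DLRules.Rule.FrontierOne τ ∧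
      ¬ DLRules.DecidableOn (fun F : DLRules.Fact => DLRules.conjOver σ F)
          (fun F => DLRules.Satisfiable DLRules.satFO F [τ] Γ) ∧
      ¬ DLRules.DecidableOn (fun F : DLRules.Fact => DLRules.conjOver σ F)
          (fun F => DLRules.Entails DLRules.satFO F [τ] Γ q)) ∧
    -- satisfiability and query answering for `FR[1] ∧ ALCF`, all data being input
    ¬ DLRules.DecidableOn
        (fun x : DLRules.Fact × List DLRules.Rule × List DLRules.ALCFConstraint =>
          ∀ τ ∈ x.2.1, DLRules.Rule.FrontierOne τ)
        (fun x => DLRules.Satisfiable DLRules.satALCF x.1 x.2.1 x.2.2) ∧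
    ¬ DLRules.DecidableOn
        (fun x : DLRules.Fact × List DLRules.Rule × List DLRules.ALCFConstraint × DLRules.BCQ =>
          ∀ τ ∈ x.2.1, DLRules.Rule.FrontierOne τ)
        (fun x => DLRules.Entails DLRules.satALCF x.1 x.2.1 x.2.2.1 x.2.2.2) ∧
    -- satisfiability and query answering for `FR[1] ∧ GC²`, all data being input
    ¬ DLRules.DecidableOn
        (fun x : DLRules.Fact × List DLRules.Rule × List DLRules.Formula =>
          (∀ τ ∈ x.2.1, DLRules.Rule.FrontierOne τ) ∧ ∀ φ ∈ x.2.2, φ.GC2Sentence)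
        (fun x => DLRules.Satisfiable DLRules.satFO x.1 x.2.1 x.2.2) ∧
    ¬ DLRules.DecidableOn
        (fun x : DLRules.Fact × List DLRules.Rule × List DLRules.Formula × DLRules.BCQ =>
          (∀ τ ∈ x.2.1, DLRules.Rule.FrontierOne τ) ∧ ∀ φ ∈ x.2.2.1, φ.GC2Sentence)
        (fun x => DLRules.Entails DLRules.satFO x.1 x.2.1 x.2.2.1 x.2.2.2) := by
  obtain ⟨G, _, gens, rels, z, e, hgens, hund⟩ := DLRules.exists_undecidable_presentation
  obtain ⟨hA, hA'⟩ := hund _ DLRules.satALCF _ (DLRules.expressAction_actionALCF hgens z e)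
  obtain ⟨hC, hC'⟩ := hund _ DLRules.satFO _ (DLRules.expressAction_actionGC2 hgens z e)
  have hfr := DLRules.actionRule_frontierOne gens rels z (hgens z)
  have hσ := DLRules.actionSignature_arity gens
  have hτ := DLRules.actionRule_over hgens rels
  have hq := DLRules.conjOver_forbiddenQuery hgens z e
  have hGC2 := DLRules.actionGC2_sentences hgens z e
  -- The rule, the constraints and the query of the uniform problems are kept constant.
  refine ⟨⟨_, _, _, _, hσ, hτ, DLRules.actionALCF_symbols hgens z e, hq, hfr, hA, hA'⟩,
    ⟨_, _, _, _, hσ, hτ, hGC2, hq, hfr, hC, hC'⟩, fun h => hA ?_, fun h => hA' ?_,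
    fun h => hC ?_, fun h => hC' ?_⟩
  · exact h.of_reduction (Computable.id.pair (Computable.const
      ([DLRules.actionRule gens rels], DLRules.actionALCF gens z e)))
      fun _ _ => ⟨List.forall_mem_singleton.2 hfr, Iff.rfl⟩
  · exact h.of_reduction (Computable.id.pair (Computable.const
      ([DLRules.actionRule gens rels], DLRules.actionALCF gens z e, DLRules.forbiddenQuery z e)))
      fun _ _ => ⟨List.forall_mem_singleton.2 hfr, Iff.rfl⟩
  · exact h.of_reduction (Computable.id.pair (Computable.const
      ([DLRules.actionRule gens rels], DLRules.actionGC2 gens z e)))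
      fun _ _ => ⟨⟨List.forall_mem_singleton.2 hfr, fun φ hφ => (hGC2 φ hφ).1⟩, Iff.rfl⟩
  · exact h.of_reduction (Computable.id.pair (Computable.const
      ([DLRules.actionRule gens rels], DLRules.actionGC2 gens z e, DLRules.forbiddenQuery z e)))
      fun _ _ => ⟨⟨List.forall_mem_singleton.2 hfr, fun φ hφ => (hGC2 φ hφ).1⟩, Iff.rfl⟩
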